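/- Let $N,K\ge 1$. A server holds $N$ files $W_1,\dots,W_N$, independent and uniform on $[2^F]$ ($F$ is the file size in bits), and serves $K$ users. A scheme with memory $M$ and rate $R$ consists of: a conditional distribution of cache contents $Z=(Z_1,\dots,Z_K)$ given $W=(W_1,\dots,W_N)$, each $Z_k$ taking at most $\lfloor 2^{MF}\rfloor$ values; for every demand vector $d\in[N]^K$, a message $X_d=X_d(W,Z)$ taking at most $\lfloor 2^{RF}\rfloor$ values; and, for every user $k$, an estimate $\widehat W_{d_k}$ that is a function of $d$, $X_d$ and $Z_k$. It is $(\epsilon,\delta)$-private if $$\max_{d}\mathbb P\big((\widehat W_{d_1},\dots,\widehat W_{d_K})\ne(W_{d_1},\dots,W_{d_K})\big)\le\epsilon,\qquad \max_{d}\max_{k} I\big((W_i)_{i\ne d_k};\,X_d,Z_k\big)\le\delta .$$ The pair $(M,R)$ is privately achievable if for all $\epsilon,\delta>0$ and all sufficiently large $F$ there is an $(\epsilon,\delta)$-private scheme with memory $M$ and rate $R$. Put $$R_C(M)=\frac{K(N+M-1)}{N+(K+1)(M-1)} .$$ (a) For $M=\frac{Nt}{K-t}+1$ with an integer $0\le t\le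 K-2$, the pair $(M,R_C(M))$ is privately achievable. (b) For $M=N(K-1)$, the pair $(M,1)$ is privately achievable. (c) For every real $M$ with $1\le M\le N(K-1)$, the pair $(M,R)$ is privately achievable, where $R$ is the value at $M$ of the lower convex envelope of the points in (a) and (b), i.e. the least $r$ such that $(M,r)$ lies in their convex hull. Moreover, for each pair in (a) and (b) there is an integer $F_1\ge1$ such that for every file size $F$ divisible by $F_1$ there is a $(0,0)$-private scheme with that memory and rate, i.e. with zero error and zero leakage. -/

import Mathlib

namespace PrivateCaching

noncomputable section

/-- The mutual information, in bits, `I(A; B) = ∑ p(a,b) log₂ (p(a,b) / (p(a) p(b)))` of a pair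
of random variables with finite alphabets and joint law `p`. -/
def mutualInfo {α β : Type*} [Fintype α] [Fintype β] (p : PMF (α × β)) : ℝ :=
  ∑ a, ∑ b, (p (a, b)).toReal *
    Real.logb 2 ((p (a, b)).toReal /
      ((p.map Prod.fst a).toReal * (p.map Prod.snd b).toReal))

/-- A placement and delivery scheme for `N` files of `F` bits and `K` users, with caches taking
`A` values and server messages taking `B` values. -/
structure Scheme (N K F A B : ℕ) where
  /-- The conditional law of the cache contents `(Z₁, …, Z_K)` given the files. -/
  placement : (Fin N → Fin (2 ^ F)) → PMF (Fin K → Fin A)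
  /-- The server message `X_d(W, Z)` for the demand vector `d`. -/
  message : (Fin K → Fin N) → (Fin N → Fin (2 ^ F)) → (Fin K → Fin A) → Fin B
  /-- The estimate of its requested file that user `k` forms, when the demand vector is `d`,
  from the content of its own cache and the server message. -/
  decode : (k : Fin K) → (d : Fin K → Fin N) → Fin A → Fin B → Fin (2 ^ F)

namespace Scheme

variable {N K F A B : ℕ}

/-- The joint law of the files and the cache contents. The files are independent and uniform,
that is, the vector of files is uniform. -/
def law (S : Scheme N K F A B) : PMF ((Fin N → Fin (2 ^ F)) × (Fin K → Fin A)) :=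
  (PMF.uniformOfFintype (Fin N → Fin (2 ^ F))).bind fun w =>
    (S.placement w).map fun z => (w, z)

/-- The probability of error `P_e`, the maximum over all demand vectors. -/
def errorProb (S : Scheme N K F A B) : ℝ :=
  ⨆ d : Fin K → Fin N,
    (S.law.toOuterMeasure
      {ω | (fun k => S.decode k d (ω.2 k) (S.message d ω.1 ω.2)) ≠ fun k => ω.1 (d k)}).toReal

/-- The joint law of the files that user `k` does not request and of what it observes, namely the
server message and the content of its own cache. -/
def viewLaw (S : Scheme N K F A B) (d : Fin K → Fin N) (k : Fin K) :
    PMF (({i : Fin N // i ≠ d k} → Fin (2 ^ F)) × (Fin B × Fin A)) :=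
  S.law.map fun ω => (fun i => ω.1 i.1, (S.message d ω.1 ω.2, ω.2 k))

/-- The information leakage `L`, the maximum over all demand vectors and all users. -/
def leakage (S : Scheme N K F A B) : ℝ :=
  ⨆ d : Fin K → Fin N, ⨆ k : Fin K, mutualInfo (S.viewLaw d k)

/-- `(ε, δ)`-private schemes. -/
def IsPrivate (S : Scheme N K F A B) (ε δ : ℝ) : Prop :=
  S.errorProb ≤ ε ∧ S.leakage ≤ δ

end Scheme

/-- There is an `(ε, δ)`-private scheme for files of `F` bits in which every cache takes values in
`[2 ^ (M F)]` and every server message takes values in `[2 ^ (R F)]`. -/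
def ExistsPrivateScheme (N K F : ℕ) (M R ε δ : ℝ) : Prop :=
  ∃ S : Scheme N K F ⌊(2 : ℝ) ^ (M * F)⌋₊ ⌊(2 : ℝ) ^ (R * F)⌋₊, S.IsPrivate ε δ

/-- The memory-rate pair `(M, R)` is privately achievable. -/
def PrivatelyAchievable (N K : ℕ) (M R : ℝ) : Prop :=
  ∀ ε > 0, ∀ δ > 0, ∃ F₀ : ℕ, ∀ F ≥ F₀, ExistsPrivateScheme N K F M R ε δ

/-- `(M, R)` is achieved with zero error and zero leakage, for all file sizes that are multiples
of a fixed positive integer. -/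
def PerfectlyAchievable (N K : ℕ) (M R : ℝ) : Prop :=
  ∃ F₁ : ℕ, 0 < F₁ ∧ ∀ F : ℕ, F₁ ∣ F → ExistsPrivateScheme N K F M R 0 0

/-- The rate `R_C(M) = K (N + M - 1) / (N + (K + 1) (M - 1))`. -/
def rateC (N K : ℕ) (M : ℝ) : ℝ :=
  K * (N + M - 1) / (N + (K + 1) * (M - 1))

/-- The memory size `N t / (K - t) + 1`. -/
def cornerMemory (N K t : ℕ) : ℝ :=
  (N : ℝ) * t / ((K : ℝ) - t) + 1

/-- The points `(M, R_C(M))` for `M = N t / (K - t) + 1`, `t ∈ {0, …, K - 2}`, together with the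
point `(N (K - 1), 1)`. -/
def cornerPoints (N K : ℕ) : Set (ℝ × ℝ) :=
  {p | ∃ t : ℕ, t + 2 ≤ K ∧ p = (cornerMemory N K t, rateC N K (cornerMemory N K t))} ∪
    {((N : ℝ) * ((K : ℝ) - 1), 1)}

end

end PrivateCaching

/-! Fix a user `u` and `0 ≤ t ≤ K - 1`. A file is cut into `(K-1).choose t` subpackets, indexed by
the `t`-sets of users avoiding `u`, and extended by zero to a `t`-set cochain on the simplex of
users. Its shares are this cochain plus the coboundary of a random cochain. User `k` caches the
shares at `T ∋ k` and a random key for each `(t+1)`-set `S ∋ k` other than the set of all users; the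
server sends, for each `(t+1)`-set `S`, the keyed sum over `j ∈ S` of the share of file `d j` at `S
\ {j}`.

Decoding: user `k` computes all shares of its file and applies the coboundary. Since the coboundary
squares to zero, the randomness disappears, and on `T ∪ {u}` only the face `T` survives
(`vertexSign_smul_coboundary_extendByZero`). Secrecy: the star of `k` is a cone, so every cochain
can be cancelled on the sets containing `k` by a coboundary (`exists_add_coboundary_eq_zero`). A
change of the other files is thus absorbed by translating the randomness, and the keys unknown to
`k` absorb the change in the remaining messages (`exists_hiding_shift`). Counting subpackets gives
the corner points, with `t = K - 1` giving `(N(K-1), 1)`.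

For other file sizes, subpackets take values in `ZMod q` with `q` a rounded-down root of `2 ^ F`;
leakage stays zero, and errors occur only at the asymptotically negligible file vectors left
uncoded. Products of schemes make the asymptotically feasible pairs a convex set, which therefore
contains the hull of the corner points. -/

namespace PrivateCaching

/-! ### Perfect schemes over arbitrary alphabets and their products -/

/-- A caching scheme with zero error and zero leakage, for files in `Φ`, caches in `Γ` and messages
in `B`, whose placement draws a uniform element of a finite set `Ω`. -/
structure PerfectScheme (N K : ℕ) (Φ Γ B : Type) where
  /-- The randomness of the placement. -/
  Ω : Type
  [fintype : Fintype Ω]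
  [nonempty : Nonempty Ω]
  /-- The cache contents. -/
  cache : (Fin N → Φ) → Ω → Fin K → Γ
  /-- The server message. -/
  message : (Fin K → Fin N) → (Fin N → Φ) → Ω → B
  /-- The estimate formed by a user. -/
  decode : Fin K → (Fin K → Fin N) → Γ → B → Φ
  -- The message may read the placement randomness, but only through the caches, as `Scheme`
  -- demands.
  message_congr : ∀ d w r r', cache w r = cache w r' → message d w r = message d w r'
  decode_eq : ∀ k d w r, decode k d (cache w r k) (message d w r) = w (d k)
  -- Exact secrecy without probability: a bijection of the uniform randomness preserves the view of
  -- user `k`, so the law of that view depends only on the requested file.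
  view_eq : ∀ k d w w', w (d k) = w' (d k) → ∃ e : Ω ≃ Ω, ∀ r,
    message d w' (e r) = message d w r ∧ cache w' (e r) k = cache w r k

attribute [instance] PerfectScheme.fintype PerfectScheme.nonempty

namespace PerfectScheme

variable {N K : ℕ} {Φ Γ B Φ' Γ' B' : Type}

/-- Two schemes used side by side, on the two components of every file. -/
def prod (P : PerfectScheme N K Φ Γ B) (Q : PerfectScheme N K Φ' Γ' B') :
    PerfectScheme N K (Φ × Φ') (Γ × Γ') (B × B') where
  Ω := P.Ω × Q.Ω
  cache w r k := (P.cache (fun n => (w n).1) r.1 k, Q.cache (fun n => (w n).2) r.2 k)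
  message d w r := (P.message d (fun n => (w n).1) r.1, Q.message d (fun n => (w n).2) r.2)
  decode k d z x := (P.decode k d z.1 x.1, Q.decode k d z.2 x.2)
  message_congr d w r r' h := by
    refine Prod.ext (P.message_congr d _ _ _ ?_) (Q.message_congr d _ _ _ ?_)
    · funext k; exact congrArg Prod.fst (congrFun h k)
    · funext k; exact congrArg Prod.snd (congrFun h k)
  decode_eq k d w r := Prod.ext (P.decode_eq k d _ _) (Q.decode_eq k d _ _)
  view_eq k d w w' h := by
    obtain ⟨e, he⟩ := P.view_eq k d (fun n => (w n).1) (fun n => (w' n).1) (congrArg Prod.fst h)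
    obtain ⟨f, hf⟩ := Q.view_eq k d (fun n => (w n).2) (fun n => (w' n).2) (congrArg Prod.snd h)
    refine ⟨e.prodCongr f, fun r => ⟨Prod.ext (he r.1).1 (hf r.2).1, Prod.ext (he r.1).2 (hf r.2).2⟩⟩

end PerfectScheme

/-- There is a perfect scheme with `p` file values, at most `a` cache values and at most `b`
message values. -/
def PerfectlyFeasible (N K p a b : ℕ) : Prop :=
  ∃ (Φ Γ B : Type) (_ : Fintype Φ) (_ : Fintype Γ) (_ : Fintype B),
    Fintype.card Φ = p ∧ Fintype.card Γ ≤ a ∧ Fintype.card B ≤ b ∧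
      Nonempty (PerfectScheme N K Φ Γ B)

theorem PerfectlyFeasible.mul {N K p a b p' a' b' : ℕ} (h : PerfectlyFeasible N K p a b)
    (h' : PerfectlyFeasible N K p' a' b') :
    PerfectlyFeasible N K (p * p') (a * a') (b * b') := by
  obtain ⟨Φ, Γ, B, _, _, _, h1, h2, h3, ⟨P⟩⟩ := h
  obtain ⟨Φ', Γ', B', _, _, _, h1', h2', h3', ⟨P'⟩⟩ := h'
  refine ⟨Φ × Φ', Γ × Γ', B × B', inferInstance, inferInstance, inferInstance, ?_, ?_, ?_,
    ⟨P.prod P'⟩⟩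
  · rw [Fintype.card_prod, h1, h1']
  · rw [Fintype.card_prod]; exact Nat.mul_le_mul h2 h2'
  · rw [Fintype.card_prod]; exact Nat.mul_le_mul h3 h3'

theorem PerfectlyFeasible.mono {N K p a b a' b' : ℕ} (h : PerfectlyFeasible N K p a b)
    (ha : a ≤ a') (hb : b ≤ b') : PerfectlyFeasible N K p a' b' := by
  obtain ⟨Φ, Γ, B, _, _, _, h1, h2, h3, P⟩ := h
  exact ⟨Φ, Γ, B, _, _, _, h1, h2.trans ha, h3.trans hb, P⟩

/-! ### The simplicial coboundary and the cone over a vertex -/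

section Coboundary

variable {U A : Type*} [LinearOrder U] [AddCommGroup A]

/-- The sign of the vertex `i` in the simplex `S`. -/
def vertexSign (i : U) (S : Finset U) : ℤ := (-1) ^ (S.filter (· < i)).card

/-- The simplicial coboundary, on functions of the simplices of all dimensions. -/
def coboundary (f : Finset U → A) (S : Finset U) : A :=
  ∑ i ∈ S, vertexSign i S • f (S.erase i)

theorem vertexSign_mul_self (i : U) (S : Finset U) : vertexSign i S * vertexSign i S = 1 := by
  rw [vertexSign, ← mul_pow]; simp

theorem coboundary_add (f g : Finset U → A) :
    coboundary (f + g) = coboundary f + coboundary g := by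
  funext S
  simp [coboundary, smul_add, Finset.sum_add_distrib]

theorem vertexSign_erase_of_lt {i j : U} {S : Finset U} (hj : j ∈ S) (h : j < i) :
    vertexSign i (S.erase j) = -vertexSign i S := by
  have h1 : (S.erase j).filter (· < i) = (S.filter (· < i)).erase j := by
    ext x; simp; tauto
  have h2 : j ∈ S.filter (· < i) := by simp [hj, h]
  rw [vertexSign, vertexSign, h1, ← Finset.card_erase_add_one h2, pow_succ]
  simp

theorem vertexSign_erase_of_gt {i j : U} {S : Finset U} (h : i < j) :
    vertexSign i (S.erase j) = vertexSign i S := by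
  have h1 : (S.erase j).filter (· < i) = S.filter (· < i) := by
    ext x
    simp only [Finset.mem_filter, Finset.mem_erase]
    exact ⟨fun hx => ⟨hx.1.2, hx.2⟩, fun hx => ⟨⟨(hx.2.trans h).ne, hx.1⟩, hx.2⟩⟩
  rw [vertexSign, vertexSign, h1]

theorem vertexSign_mul_vertexSign_erase {i j : U} {S : Finset U} (hi : i ∈ S) (hj : j ∈ S)
    (hij : i ≠ j) :
    vertexSign i S * vertexSign j (S.erase i) = -(vertexSign j S * vertexSign i (S.erase j)) := by
  rcases lt_or_gt_of_ne hij with h | h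
  · rw [vertexSign_erase_of_lt hi h, vertexSign_erase_of_gt h]; ring
  · rw [vertexSign_erase_of_gt h, vertexSign_erase_of_lt hj h]; ring

/-- Removing `i` then `j` and removing `j` then `i` give the same face with opposite signs. -/
theorem coboundary_coboundary (f : Finset U → A) : coboundary (coboundary f) = 0 := by
  funext S
  simp only [coboundary, Finset.smul_sum, smul_smul, Pi.zero_apply]
  rw [Finset.sum_sigma']
  refine Finset.sum_involution (fun p _ => ⟨p.2, p.1⟩) ?_ ?_ ?_ ?_
  · rintro ⟨i, j⟩ h
    simp only [Finset.mem_sigma, Finset.mem_erase] at h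
    simp only
    rw [vertexSign_mul_vertexSign_erase h.1 h.2.2 (Ne.symm h.2.1), Finset.erase_right_comm,
      neg_smul, neg_add_cancel]
  · rintro ⟨i, j⟩ h _ he
    simp only [Finset.mem_sigma, Finset.mem_erase] at h
    exact h.2.1 (congrArg Sigma.fst he)
  · rintro ⟨i, j⟩ h
    simp only [Finset.mem_sigma, Finset.mem_erase] at h ⊢
    exact ⟨h.2.2, Ne.symm h.2.1, h.1⟩
  · rintro ⟨i, j⟩ h
    rfl

theorem exists_add_coboundary_eq_zero (f : Finset U → A) (k : U) :
    ∃ h : Finset U → A, ∀ T, k ∈ T → f T + coboundary h T = 0 := by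
  -- This is the cone homotopy with apex `k`: when `k ∈ T`, the only face on which `h` is nonzero is
  -- `T.erase k`.
  refine ⟨fun V => if k ∈ V then 0 else -(vertexSign k (insert k V) • f (insert k V)),
    fun T hT => ?_⟩
  rw [coboundary, ← Finset.add_sum_erase _ _ hT, Finset.sum_eq_zero]
  · simp [Finset.insert_erase hT, smul_smul, vertexSign_mul_self]
  · intro i hi
    rw [if_pos (Finset.mem_erase.2 ⟨(Finset.ne_of_mem_erase hi).symm, hT⟩), smul_zero]

variable {t : ℕ} {u : U}

/-- A function of the `t`-sets that avoid `u`, extended by zero. -/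
def extendByZero (v : {T : Finset U // T.card = t ∧ u ∉ T} → A) (T : Finset U) : A :=
  if h : T.card = t ∧ u ∉ T then v ⟨T, h⟩ else 0

theorem extendByZero_add (v v' : {T : Finset U // T.card = t ∧ u ∉ T} → A) :
    extendByZero (v + v') = extendByZero v + extendByZero v' := by
  funext T
  by_cases h : T.card = t ∧ u ∉ T <;> simp [extendByZero, h]

/-- The coboundary kills the randomness, and every face of `insert u T` other than `T` contains `u`,
where the extension by zero vanishes. -/
theorem vertexSign_smul_coboundary_extendByZero
    (v : {T : Finset U // T.card = t ∧ u ∉ T} → A) (h : Finset U → A)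
    (T : {T : Finset U // T.card = t ∧ u ∉ T}) :
    vertexSign u (insert u T.1) • coboundary (extendByZero v + coboundary h) (insert u T.1) =
      v T := by
  rw [coboundary_add, coboundary_coboundary, add_zero, coboundary,
    ← Finset.add_sum_erase _ _ (Finset.mem_insert_self u T.1), Finset.sum_eq_zero, add_zero,
    smul_smul, vertexSign_mul_self, one_smul, Finset.erase_insert T.2.2, extendByZero,
    dif_pos T.2]
  intro i hi
  rw [extendByZero, dif_neg, smul_zero]
  rintro ⟨-, h⟩
  exact h (Finset.mem_erase.2 ⟨(Finset.ne_of_mem_erase hi).symm, Finset.mem_insert_self _ _⟩)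

end Coboundary

/-! ### The secret sharing scheme: decoding and hiding -/

section Base

variable {N K : ℕ} (t : ℕ) (u : Fin K) (A : Type) [AddCommGroup A]

/-- The files of the secret sharing scheme: functions of the `t`-sets of users that avoid `u`. -/
abbrev ShareFile : Type := {T : Finset (Fin K) // T.card = t ∧ u ∉ T} → A

variable {t u A}

/-- The shares of the files, with randomness `h`. -/
def shares (w : Fin N → ShareFile t u A) (h : Fin N → Finset (Fin K) → A) (n : Fin N) :
    Finset (Fin K) → A :=
  extendByZero (w n) + coboundary (h n)

/-- The key of the set `S`; the set of all users has none. -/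
def keyValue (κ : Finset (Fin K) → A) (S : Finset (Fin K)) : A :=
  if S = Finset.univ then 0 else κ S

theorem shares_add (w w' : Fin N → ShareFile t u A) (h h' : Fin N → Finset (Fin K) → A) :
    shares (w + w') (h + h') = shares w h + shares w' h' := by
  funext n
  simp only [shares, Pi.add_apply, extendByZero_add, coboundary_add]
  abel

/-- The message for the set `S` of users. -/
def setMessage (d : Fin K → Fin N) (f : Fin N → Finset (Fin K) → A) (κ : Finset (Fin K) → A)
    (S : Finset (Fin K)) : A :=
  ∑ j ∈ S, f (d j) (S.erase j) + keyValue κ S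

theorem setMessage_add (d : Fin K → Fin N) (f f' : Fin N → Finset (Fin K) → A)
    (κ κ' : Finset (Fin K) → A) (S : Finset (Fin K)) :
    setMessage d (f + f') (κ + κ') S = setMessage d f κ S + setMessage d f' κ' S := by
  by_cases h : S = Finset.univ <;>
    simp [setMessage, keyValue, h, Finset.sum_add_distrib]; abel

/-- What one user caches: shares of all the files and keys. -/
abbrev ShareCache (N t : ℕ) {K : ℕ} (A : Type) (k : Fin K) : Type :=
  (Fin N × {T : Finset (Fin K) // T.card = t ∧ k ∈ T} → A) ×
    ({S : Finset (Fin K) // S.card = t + 1 ∧ k ∈ S ∧ S ≠ Finset.univ} → A)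

/-- The cache of user `k`. -/
def shareCache (w : Fin N → ShareFile t u A) (h : Fin N → Finset (Fin K) → A)
    (κ : Finset (Fin K) → A) (k : Fin K) : ShareCache N t A k :=
  (fun p => shares w h p.1 p.2.1, fun S => κ S.1)

/-- The share that a user reads off its cache. -/
def cachedShare {k : Fin K} (z : ShareCache N t A k) (n : Fin N) (T : Finset (Fin K)) : A :=
  if hT : T.card = t ∧ k ∈ T then z.1 (n, ⟨T, hT⟩) else 0

/-- The key that a user reads off its cache. -/
def cachedKey {k : Fin K} (z : ShareCache N t A k) (S : Finset (Fin K)) : A :=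
  if hS : S.card = t + 1 ∧ k ∈ S ∧ S ≠ Finset.univ then z.2 ⟨S, hS⟩ else 0

/-- The share of its requested file that user `k` computes from its cache and the message. -/
def recoveredShare (d : Fin K → Fin N) {k : Fin K} (z : ShareCache N t A k)
    (x : {S : Finset (Fin K) // S.card = t + 1} → A) (T : Finset (Fin K)) : A :=
  if k ∈ T then cachedShare z (d k) T else
    if hT : (insert k T).card = t + 1 then
      x ⟨insert k T, hT⟩ - cachedKey z (insert k T) -
        ∑ j ∈ T, cachedShare z (d j) ((insert k T).erase j)
    else 0

/-- In the message for `insert k T`, all terms except the share at `T` are evaluated at sets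
containing `k`, hence cached. The default value `0` of `cachedKey` agrees with the missing key of
the full set. -/
theorem recoveredShare_eq (d : Fin K → Fin N) (k : Fin K) (w : Fin N → ShareFile t u A)
    (h : Fin N → Finset (Fin K) → A) (κ : Finset (Fin K) → A) (T : Finset (Fin K))
    (hT : T.card = t) :
    recoveredShare d (shareCache w h κ k) (fun S => setMessage d (shares w h) κ S.1) T =
      shares w h (d k) T := by
  by_cases hk : k ∈ T
  · simp [recoveredShare, hk, cachedShare, hT, shareCache]
  · have hc : (insert k T).card = t + 1 := by rw [Finset.card_insert_of_notMem hk, hT]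
    have hkey : cachedKey (shareCache w h κ k) (insert k T) = keyValue κ (insert k T) := by
      by_cases hS : insert k T = Finset.univ <;> simp [cachedKey, keyValue, hS, hc, shareCache]
    rw [recoveredShare, if_neg hk, dif_pos hc, hkey, setMessage, Finset.sum_insert hk,
      Finset.erase_insert hk]
    have hsum : ∑ j ∈ T, cachedShare (shareCache w h κ k) (d j) ((insert k T).erase j) =
        ∑ j ∈ T, shares w h (d j) ((insert k T).erase j) := by
      refine Finset.sum_congr rfl fun j hj => ?_
      have h1 : ((insert k T).erase j).card = t ∧ k ∈ (insert k T).erase j := by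
        refine ⟨?_, Finset.mem_erase.2 ⟨fun e => hk (e ▸ hj), Finset.mem_insert_self _ _⟩⟩
        rw [Finset.card_erase_of_mem (Finset.mem_insert_of_mem hj), hc, Nat.add_sub_cancel]
      rw [cachedShare, dif_pos h1]
      rfl
    rw [hsum]
    abel

theorem setMessage_congr (d : Fin K → Fin N) (w : Fin N → ShareFile t u A)
    (h h' : Fin N → Finset (Fin K) → A) (κ κ' : Finset (Fin K) → A)
    (hz : ∀ k, shareCache w h κ k = shareCache w h' κ' k) (S : Finset (Fin K))
    (hS : S.card = t + 1) :
    setMessage d (shares w h) κ S = setMessage d (shares w h') κ' S := by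
  have hf : ∀ n T, T.card = t → shares w h n T = shares w h' n T := by
    intro n T hT
    rcases T.eq_empty_or_nonempty with rfl | ⟨k, hk⟩
    -- For `t = 0` no user caches the share at `∅`, but a coboundary vanishes there, so this share
    -- is determined by the file.
    · simp [shares, coboundary]
    · exact congrFun (congrArg Prod.fst (hz k)) (n, ⟨T, hT, hk⟩)
  have hκ : keyValue κ S = keyValue κ' S := by
    by_cases hu : S = Finset.univ
    · simp [keyValue, hu]
    · obtain ⟨k, hk⟩ := Finset.card_pos.1 (by omega : 0 < S.card)
      simp only [keyValue, if_neg hu]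
      exact congrFun (congrArg Prod.snd (hz k)) ⟨S, hS, hk, hu⟩
  rw [setMessage, setMessage, hκ]
  congr 1
  refine Finset.sum_congr rfl fun j hj => hf _ _ ?_
  rw [Finset.card_erase_of_mem hj, hS, Nat.add_sub_cancel]

/-- By linearity, secrecy reduces to a difference `w` of file vectors that vanishes at the requested
file: some randomness must make it invisible to user `k`. The requested file gets zero randomness,
so that its shares vanish everywhere. -/
theorem exists_hiding_shift (d : Fin K → Fin N) (k : Fin K) (w : Fin N → ShareFile t u A)
    (hw : w (d k) = 0) :
    ∃ (h : Fin N → Finset (Fin K) → A) (κ : Finset (Fin K) → A),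
      (∀ n T, k ∈ T → shares w h n T = 0) ∧ (∀ S, k ∈ S → κ S = 0) ∧
      ∀ S, setMessage d (shares w h) κ S = 0 := by
  have key : ∀ n, ∃ g : Finset (Fin K) → A,
      (∀ T, k ∈ T → (extendByZero (w n) + coboundary g) T = 0) ∧ (n = d k → g = 0) := by
    intro n
    by_cases hn : n = d k
    · refine ⟨0, fun T _ => ?_, fun _ => rfl⟩
      subst hn
      simp [hw, extendByZero, coboundary]
    · obtain ⟨g, hg⟩ := exists_add_coboundary_eq_zero (extendByZero (w n)) k
      exact ⟨g, hg, fun e => absurd e hn⟩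
  choose h h1 h2 using key
  -- User `k` does not hold the keys of the sets avoiding `k`, so these can cancel the messages
  -- there. The messages for sets containing `k`, including the keyless full set, vanish term by
  -- term.
  refine ⟨h, fun S => if k ∈ S then 0 else -∑ j ∈ S, shares w h (d j) (S.erase j),
    h1, fun S hS => if_pos hS, fun S => ?_⟩
  have hdk : ∀ T, shares w h (d k) T = 0 := by
    intro T
    simp [shares, h2 (d k) rfl, hw, extendByZero, coboundary]
  by_cases hS : k ∈ S
  · rw [setMessage, Finset.sum_eq_zero, keyValue, if_pos hS, ite_self, add_zero]
    intro j hj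
    by_cases hjk : j = k
    · rw [hjk, hdk]
    · exact h1 _ _ (Finset.mem_erase.2 ⟨Ne.symm hjk, hS⟩)
  · have hu : S ≠ Finset.univ := fun e => hS (e ▸ Finset.mem_univ k)
    rw [setMessage, keyValue, if_neg hu, if_neg hS, add_neg_cancel]

end Base

section Base

variable {N K t m : ℕ} {u : Fin K} {A : Type} [AddCommGroup A]

/-- The secret sharing scheme, with caches relabelled by `Fin m`. -/
def shareScheme [Fintype A] (u : Fin K) (e : ∀ k : Fin K, ShareCache N t A k ≃ Fin m) :
    PerfectScheme N K (ShareFile t u A) (Fin m) ({S : Finset (Fin K) // S.card = t + 1} → A) where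
  Ω := (Fin N → Finset (Fin K) → A) × (Finset (Fin K) → A)
  cache w r k := e k (shareCache w r.1 r.2 k)
  message d w r S := setMessage d (shares w r.1) r.2 S.1
  decode k d z x T := vertexSign u (insert u T.1) •
    coboundary (recoveredShare d ((e k).symm z) x) (insert u T.1)
  message_congr d w r r' hz := by
    funext S
    exact setMessage_congr d w r.1 r'.1 r.2 r'.2 (fun k => (e k).injective (congrFun hz k)) S.1 S.2
  decode_eq k d w r := by
    funext T
    rw [Equiv.symm_apply_apply, ← vertexSign_smul_coboundary_extendByZero (w (d k)) (r.1 (d k)) T]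
    congr 1
    refine Finset.sum_congr rfl fun j hj => ?_
    rw [recoveredShare_eq, shares]
    rw [Finset.card_erase_of_mem hj, Finset.card_insert_of_notMem T.2.2, T.2.1, Nat.add_sub_cancel]
  view_eq k d w w' hw := by
    obtain ⟨h, κ, h1, h2, h3⟩ := exists_hiding_shift d k (w' - w)
      (by rw [Pi.sub_apply, hw, sub_self])
    have hs : ∀ r : Fin N → Finset (Fin K) → A,
        shares w' (r + h) = shares w r + shares (w' - w) h := by
      intro r
      rw [← shares_add, add_sub_cancel]
    refine ⟨Equiv.addRight (h, κ), fun r => ⟨?_, congrArg (e k) (Prod.ext ?_ ?_)⟩⟩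
    · funext S
      simp only [Equiv.coe_addRight, Prod.fst_add, Prod.snd_add]
      rw [hs, setMessage_add, h3, add_zero]
    · funext p
      simp only [Equiv.coe_addRight, Prod.fst_add, shareCache]
      rw [hs, Pi.add_apply, Pi.add_apply, h1 _ _ p.2.2.2, add_zero]
    · funext S
      simp only [Equiv.coe_addRight, Prod.snd_add, shareCache, Pi.add_apply]
      rw [h2 _ S.2.2.1, add_zero]

/-! ### Counting subpackets -/

theorem card_sets_avoiding (k : Fin K) (t : ℕ) :
    Fintype.card {T : Finset (Fin K) // T.card = t ∧ k ∉ T} = (K - 1).choose t := by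
  rw [Fintype.card_subtype]
  have : (Finset.univ.filter fun T : Finset (Fin K) => T.card = t ∧ k ∉ T) =
      Finset.powersetCard t (Finset.univ.erase k) := by
    ext T
    simp only [Finset.mem_filter, Finset.mem_univ, true_and, Finset.mem_powersetCard,
      Finset.subset_erase, Finset.subset_univ]
    tauto
  rw [this, Finset.card_powersetCard, Finset.card_erase_of_mem (Finset.mem_univ k),
    Finset.card_univ, Fintype.card_fin]

theorem card_sets (K t : ℕ) :
    Fintype.card {T : Finset (Fin K) // T.card = t} = K.choose t := by
  simp

theorem card_sets_containing (k : Fin K) (t : ℕ) :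
    Fintype.card {T : Finset (Fin K) // T.card = t ∧ k ∈ T} = K.choose t - (K - 1).choose t := by
  have h := card_sets_avoiding k t
  rw [Fintype.card_subtype] at h ⊢
  have h2 := card_sets K t
  rw [Fintype.card_subtype] at h2
  rw [← h2, ← h, eq_tsub_iff_add_eq_of_le (Finset.card_le_card fun T => by simp; tauto),
    ← Finset.filter_filter, ← Finset.filter_filter]
  exact Finset.card_filter_add_card_filter_not _

theorem choose_sub_choose_pred {K : ℕ} (hK : 1 ≤ K) (t : ℕ) :
    K.choose (t + 1) - (K - 1).choose (t + 1) = (K - 1).choose t := by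
  obtain ⟨n, rfl⟩ := Nat.exists_eq_add_of_le' hK
  rw [Nat.choose_succ_succ, Nat.add_sub_cancel, Nat.add_sub_cancel]

theorem card_key_sets (k : Fin K) (t : ℕ) :
    Fintype.card {S : Finset (Fin K) // S.card = t + 1 ∧ k ∈ S ∧ S ≠ Finset.univ} =
      if t + 1 = K then 0 else (K - 1).choose t := by
  have hK : 1 ≤ K := by have := k.2; omega
  split_ifs with h
  · rw [Fintype.card_eq_zero_iff]
    refine ⟨fun S => S.2.2.2 ?_⟩
    rw [← Finset.card_eq_iff_eq_univ, Fintype.card_fin, S.2.1, h]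
  · rw [← choose_sub_choose_pred hK t, ← card_sets_containing k]
    refine Fintype.card_congr (Equiv.subtypeEquivRight fun S => ?_)
    refine ⟨fun hS => ⟨hS.1, hS.2.1⟩, fun hS => ⟨hS.1, hS.2, fun e => h ?_⟩⟩
    rw [← hS.1, e, Finset.card_univ, Fintype.card_fin]

/-- The number of subpackets in a cache. -/
def cacheSubpackets (N K t : ℕ) : ℕ :=
  N * (K.choose t - (K - 1).choose t) + if t + 1 = K then 0 else (K - 1).choose t

end Base

theorem card_shareCache (N t : ℕ) {K : ℕ} (A : Type) [Fintype A] (k : Fin K) :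
    Fintype.card (ShareCache N t A k) = Fintype.card A ^ cacheSubpackets N K t := by
  rw [Fintype.card_prod, Fintype.card_fun, Fintype.card_fun, Fintype.card_prod, Fintype.card_fin,
    card_sets_containing, card_key_sets, ← pow_add, cacheSubpackets]

theorem perfectlyFeasible_pow (N : ℕ) {K : ℕ} (hK : 1 ≤ K) (t q : ℕ) (hq : q ≠ 0) :
    PerfectlyFeasible N K (q ^ (K - 1).choose t) (q ^ cacheSubpackets N K t)
      (q ^ K.choose (t + 1)) := by
  have : NeZero q := ⟨hq⟩
  let u : Fin K := ⟨0, hK⟩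
  refine ⟨ShareFile t u (ZMod q), Fin (q ^ cacheSubpackets N K t),
    {S : Finset (Fin K) // S.card = t + 1} → ZMod q, inferInstance, inferInstance, inferInstance,
    ?_, ?_, ?_, ⟨shareScheme u fun k => Fintype.equivFinOfCardEq ?_⟩⟩
  · rw [Fintype.card_fun, card_sets_avoiding, ZMod.card]
  · rw [Fintype.card_fin]
  · rw [Fintype.card_fun, card_sets, ZMod.card]
  · rw [card_shareCache, ZMod.card]

theorem choose_mul_sub {K t : ℕ} (hK : 1 ≤ K) (ht : t + 1 ≤ K) :
    (K.choose t - (K - 1).choose t) * (K - t) = (K - 1).choose t * t := by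
  obtain ⟨n, rfl⟩ := Nat.exists_eq_add_of_le' hK
  rw [Nat.add_sub_cancel, Nat.sub_mul, ← Nat.choose_mul_succ_eq, ← Nat.mul_sub]
  congr 1
  omega

/-- Relative to the `(K-1).choose t` subpackets of a file, the shares contribute `N t / (K - t)` and
the keys contribute `1`. -/
theorem cacheSubpackets_eq_cornerMemory (N : ℕ) {K t : ℕ} (ht : t + 2 ≤ K) :
    (cacheSubpackets N K t : ℝ) = cornerMemory N K t * ((K - 1).choose t : ℕ) := by
  have h := choose_mul_sub (K := K) (t := t) (by omega) (by omega)
  have h' : ((K.choose t - (K - 1).choose t : ℕ) : ℝ) * ((K : ℝ) - t) =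
      ((K - 1).choose t : ℕ) * t := by
    rw [← Nat.cast_sub (by omega)]
    exact_mod_cast h
  have hpos : (K : ℝ) - t ≠ 0 := by
    have : (t : ℝ) + 2 ≤ K := by exact_mod_cast ht
    linarith
  rw [cacheSubpackets, if_neg (by omega), cornerMemory]
  push_cast
  field_simp
  linear_combination (N : ℝ) * h'

theorem cacheSubpackets_pred (N : ℕ) {K : ℕ} (hK : 1 ≤ K) :
    (cacheSubpackets N K (K - 1) : ℝ) = N * ((K : ℝ) - 1) * ((K - 1).choose (K - 1) : ℕ) := by
  obtain ⟨n, rfl⟩ := Nat.exists_eq_add_of_le' hK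
  rw [cacheSubpackets, if_pos (by omega), Nat.add_sub_cancel, Nat.choose_self,
    Nat.choose_succ_self_right]
  simp

theorem choose_succ_eq_rateC {N K t : ℕ} (hN : 1 ≤ N) (ht : t + 2 ≤ K) :
    (K.choose (t + 1) : ℝ) = rateC N K (cornerMemory N K t) * ((K - 1).choose t : ℕ) := by
  have hr : rateC N K (cornerMemory N K t) = K / ((t : ℝ) + 1) := by
    have h2 : (t : ℝ) + 2 ≤ K := by exact_mod_cast ht
    have hpos : (0 : ℝ) < (K : ℝ) - t := by linarith
    have hK : (0 : ℝ) < K := by have : (0 : ℝ) ≤ t := t.cast_nonneg; linarith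
    have hN' : (0 : ℝ) < N := by exact_mod_cast hN
    have ht1 : (0 : ℝ) < (t : ℝ) + 1 := by positivity
    have e1 : (N : ℝ) + cornerMemory N K t - 1 = N * K / (K - t) := by
      rw [cornerMemory]; field_simp; ring
    have e2 : (N : ℝ) + (K + 1) * (cornerMemory N K t - 1) = N * K * (t + 1) / (K - t) := by
      rw [cornerMemory]; field_simp; ring
    rw [rateC, e1, e2]
    field_simp
  have h := Nat.add_one_mul_choose_eq (K - 1) t
  rw [Nat.sub_add_cancel (by omega)] at h
  have h' : (K : ℝ) * ((K - 1).choose t : ℕ) = (K.choose (t + 1) : ℕ) * ((t : ℝ) + 1) := by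
    exact_mod_cast h
  rw [hr]
  field_simp
  linarith

/-! ### Product laws and vanishing mutual information -/

theorem bind_map_mk_apply {α β : Type*} (p : PMF α) (q : PMF β) (a : α) (b : β) :
    (p.bind fun x => q.map (Prod.mk x)) (a, b) = p a * q b := by
  classical
  rw [PMF.bind_apply, tsum_eq_single a]
  · congr 1
    rw [PMF.map_apply, tsum_eq_single b]
    · simp
    · intro b' hb
      simp [hb.symm]
  · intro a' ha
    rw [PMF.map_apply, ENNReal.tsum_eq_zero.2, mul_zero]
    intro b'
    simp [ha.symm]

theorem mutualInfo_bind_map_mk {α β : Type*} [Fintype α] [Fintype β] (p : PMF α) (q : PMF β) :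
    mutualInfo (p.bind fun x => q.map (Prod.mk x)) = 0 := by
  have h1 : (p.bind fun x => q.map (Prod.mk x)).map Prod.fst = p := by
    simp only [PMF.map_bind, PMF.map_comp]
    calc _ = p.bind PMF.pure := by
          congr 1; funext x
          exact PMF.map_const q x
      _ = p := PMF.bind_pure p
  have h2 : (p.bind fun x => q.map (Prod.mk x)).map Prod.snd = q := by
    simp only [PMF.map_bind, PMF.map_comp]
    calc _ = p.bind fun _ => q := by
          congr 1; funext x
          exact PMF.map_id q
      _ = q := PMF.bind_const p q
  rw [mutualInfo, h1, h2]
  refine Finset.sum_eq_zero fun a _ => Finset.sum_eq_zero fun b _ => ?_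
  rw [bind_map_mk_apply, ENNReal.toReal_mul]
  by_cases h : (p a).toReal * (q b).toReal = 0
  · rw [h, zero_mul]
  · rw [div_self h, Real.logb_one, mul_zero]

theorem map_equiv_uniformOfFintype {α β : Type*} [Fintype α] [Nonempty α] [Fintype β] [Nonempty β]
    (e : α ≃ β) : (PMF.uniformOfFintype α).map e = PMF.uniformOfFintype β := by
  classical
  ext b
  rw [PMF.map_apply, tsum_eq_single (e.symm b)]
  · simp [Fintype.card_congr e]
  · intro a ha
    rw [if_neg]
    rintro rfl
    simp at ha

theorem uniformOfFintype_prod {α β : Type*} [Fintype α] [Nonempty α] [Fintype β] [Nonempty β] :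
    PMF.uniformOfFintype (α × β) =
      (PMF.uniformOfFintype α).bind fun a => (PMF.uniformOfFintype β).map (Prod.mk a) := by
  ext ⟨a, b⟩
  rw [bind_map_mk_apply]
  simp [ENNReal.mul_inv]

/-- If the law of an observation depends only on one coordinate, it carries no information about
the other coordinates of a uniform vector. -/
theorem mutualInfo_uniform_eq_zero {ι α β : Type*} [Fintype ι] [DecidableEq ι] [Fintype α]
    [Nonempty α] [Fintype β] (i : ι) (V : (ι → α) → PMF β)
    (hV : ∀ w w', w i = w' i → V w = V w') :
    mutualInfo ((PMF.uniformOfFintype (ι → α)).bind fun w =>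
      (V w).map (Prod.mk fun j : {j // j ≠ i} => w j.1)) = 0 := by
  let e : ({j // j ≠ i} → α) × α ≃ (ι → α) :=
    (Equiv.prodComm _ _).trans (Equiv.funSplitAt i α).symm
  have hei : ∀ x, e x i = x.2 := fun x => by simp [e, Equiv.funSplitAt, Equiv.piSplitAt]
  have her : ∀ x, (fun j : {j // j ≠ i} => e x j.1) = x.1 := fun x => by
    funext j; simp [e, Equiv.funSplitAt, Equiv.piSplitAt, j.2]
  -- Freezing the other coordinates at `c` leaves the law of the observation unchanged and exhibits
  -- the joint law as a product.
  let c : ({j // j ≠ i} → α) := fun _ => Classical.arbitrary α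
  have hc : ∀ x, V (e x) = V (e (c, x.2)) := fun x => hV _ _ (by rw [hei, hei])
  rw [← map_equiv_uniformOfFintype e, PMF.bind_map, uniformOfFintype_prod, PMF.bind_bind]
  simp only [PMF.bind_map, Function.comp_def, her]
  simp only [hc]
  simp only [← PMF.map_bind]
  exact mutualInfo_bind_map_mk _ _

/-! ### From perfect schemes to schemes on bit strings -/

namespace PerfectScheme

variable {N K F a b : ℕ} {Φ Γ B : Type}

/-- The randomized scheme obtained from a perfect scheme by encoding its alphabets. -/
noncomputable def toScheme (P : PerfectScheme N K Φ Γ B) (φ : Φ → Fin (2 ^ F)) (ψ : Fin (2 ^ F) → Φ)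
    (γ : Γ → Fin a) (γ' : Fin a → Γ) (β : B → Fin b) (β' : Fin b → B) : Scheme N K F a b where
  placement w := (PMF.uniformOfFintype P.Ω).map fun r k => γ (P.cache (ψ ∘ w) r k)
  message d w z := β (P.message d (ψ ∘ w)
    (Classical.epsilon fun r => (fun k => γ (P.cache (ψ ∘ w) r k)) = z))
  decode k d z x := φ (P.decode k d (γ' z) (β' x))

variable (P : PerfectScheme N K Φ Γ B) (φ : Φ → Fin (2 ^ F)) (ψ : Fin (2 ^ F) → Φ)
  {γ : Γ → Fin a} {γ' : Fin a → Γ} {β : B → Fin b} {β' : Fin b → B}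

theorem toScheme_message (hγ : Function.LeftInverse γ' γ) (d : Fin K → Fin N)
    (w : Fin N → Fin (2 ^ F)) (r : P.Ω) :
    (P.toScheme φ ψ γ γ' β β').message d w (fun k => γ (P.cache (ψ ∘ w) r k)) =
      β (P.message d (ψ ∘ w) r) := by
  refine congrArg β (P.message_congr _ _ _ _ ?_)
  have h := Classical.epsilon_spec (p := fun r' => (fun k => γ (P.cache (ψ ∘ w) r' k)) =
    fun k => γ (P.cache (ψ ∘ w) r k)) ⟨r, rfl⟩
  funext k
  exact hγ.injective (congrFun h k)

theorem toScheme_leakage (hγ : Function.LeftInverse γ' γ) :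
    (P.toScheme φ ψ γ γ' β β').leakage ≤ 0 := by
  refine Real.iSup_le (fun d => Real.iSup_le (fun k => le_of_eq ?_) le_rfl) le_rfl
  rw [← mutualInfo_uniform_eq_zero (α := Fin (2 ^ F)) (d k) (fun w =>
    (PMF.uniformOfFintype P.Ω).map fun r =>
      (β (P.message d (ψ ∘ w) r), γ (P.cache (ψ ∘ w) r k)))]
  · congr 1
    rw [Scheme.viewLaw, Scheme.law, PMF.map_bind]
    congr 1
    funext w
    rw [toScheme, PMF.map_comp, PMF.map_comp, PMF.map_comp]
    congr 1
    funext r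
    have := P.toScheme_message φ ψ (β := β) (β' := β') hγ d w r
    simp only [toScheme] at this
    simp only [Function.comp_apply, this]
  · intro w w' hw
    obtain ⟨e, he⟩ := P.view_eq k d (ψ ∘ w) (ψ ∘ w') (congrArg ψ hw)
    conv_rhs => rw [← map_equiv_uniformOfFintype e, PMF.map_comp]
    congr 1
    funext r
    simp only [Function.comp_apply, he]

theorem toScheme_errorProb [Fintype Φ] (hφ : Function.LeftInverse ψ φ)
    (hγ : Function.LeftInverse γ' γ) (hβ : Function.LeftInverse β' β) :
    (P.toScheme φ ψ γ γ' β β').errorProb ≤ 1 - ((Fintype.card Φ : ℝ) / 2 ^ F) ^ N := by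
  classical
  have hcard : Fintype.card Φ ≤ 2 ^ F := by
    simpa using Fintype.card_le_of_injective φ hφ.injective
  have hc : ((Fintype.card Φ : ℝ) / 2 ^ F) ^ N ≤ 1 := by
    refine pow_le_one₀ (by positivity) ((div_le_one (by positivity)).2 ?_)
    exact_mod_cast hcard
  refine Real.iSup_le (fun d => ?_) (sub_nonneg.2 hc)
  let good : Finset (Fin N → Fin (2 ^ F)) := Fintype.piFinset fun _ => Finset.univ.image φ
  -- Decoding is correct whenever all files lie in the image of `φ`, so the error is at most the
  -- proportion of the other file vectors.
  have hgood : good.card = Fintype.card Φ ^ N := by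
    rw [Fintype.card_piFinset_const, Finset.card_image_of_injective _ hφ.injective,
      Finset.card_univ]
  have hle : (P.toScheme φ ψ γ γ' β β').law.toOuterMeasure
      {ω | (fun k => (P.toScheme φ ψ γ γ' β β').decode k d (ω.2 k)
        ((P.toScheme φ ψ γ γ' β β').message d ω.1 ω.2)) ≠ fun k => ω.1 (d k)} ≤
      ENNReal.ofReal (1 - ((Fintype.card Φ : ℝ) / 2 ^ F) ^ N) := by
    rw [Scheme.law, PMF.toOuterMeasure_bind_apply, tsum_fintype]
    calc _ ≤ ∑ w : Fin N → Fin (2 ^ F), ((2 ^ F) ^ N : ENNReal)⁻¹ * if w ∈ good then 0 else 1 := by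
          refine Finset.sum_le_sum fun w _ => ?_
          rw [PMF.uniformOfFintype_apply, Fintype.card_fun, Fintype.card_fin, Fintype.card_fin]
          push_cast
          gcongr
          split_ifs with hw
          · rw [le_zero_iff, PMF.toOuterMeasure_apply_eq_zero_iff, Set.disjoint_left]
            intro x hx
            rw [toScheme, PMF.map_comp, PMF.support_map] at hx
            obtain ⟨r, -, rfl⟩ := hx
            simp only [Set.mem_ofPred_eq, not_not, Function.comp_apply]
            funext k
            rw [toScheme_message _ _ _ hγ]
            simp only [toScheme]
            rw [hγ, hβ, P.decode_eq]
            obtain ⟨x, -, hx⟩ := Finset.mem_image.1 (Fintype.mem_piFinset.1 hw (d k))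
            rw [Function.comp_apply, ← hx, hφ]
          · refine (PMF.toOuterMeasure_mono _ (Set.subset_univ _)).trans ?_
            rw [(PMF.toOuterMeasure_apply_eq_one_iff _ _).2 (Set.subset_univ _)]
      _ = ((2 ^ F) ^ N : ENNReal)⁻¹ * (((2 ^ F) ^ N - Fintype.card Φ ^ N : ℕ) : ENNReal) := by
          rw [← Finset.mul_sum]
          congr 1
          have h2 := Finset.card_compl good
          rw [Fintype.card_fun, Fintype.card_fin, Fintype.card_fin, hgood] at h2
          rw [← h2]
          simp [Finset.sum_ite, Finset.filter_notMem_eq_sdiff, Finset.compl_eq_univ_sdiff]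
      _ = _ := by
          have h1 : 1 - ((Fintype.card Φ : ℝ) / 2 ^ F) ^ N =
              ((2 ^ F) ^ N : ℝ)⁻¹ * (((2 ^ F) ^ N - Fintype.card Φ ^ N : ℕ) : ℝ) := by
            rw [Nat.cast_sub (Nat.pow_le_pow_left hcard N), div_pow]
            push_cast
            field_simp
          rw [h1, ENNReal.ofReal_mul (by positivity), ENNReal.ofReal_inv_of_pos (by positivity),
            ENNReal.ofReal_natCast, ENNReal.ofReal_pow (by positivity),
            ENNReal.ofReal_pow (by positivity), ENNReal.ofReal_ofNat]
  refine ENNReal.toReal_le_of_le_ofReal (sub_nonneg.2 hc) hle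

end PerfectScheme

theorem PerfectlyFeasible.existsPrivateScheme {N K F p : ℕ} {M R ε : ℝ}
    (hN : 1 ≤ N) (hK : 1 ≤ K)
    (h : PerfectlyFeasible N K p ⌊(2 : ℝ) ^ (M * F)⌋₊ ⌊(2 : ℝ) ^ (R * F)⌋₊) (hp₀ : 0 < p)
    (hp : p ≤ 2 ^ F)
    (hε : 1 - ((p : ℝ) / 2 ^ F) ^ N ≤ ε) : ExistsPrivateScheme N K F M R ε 0 := by
  obtain ⟨Φ, Γ, B, _, _, _, rfl, hΓ, hB, ⟨P⟩⟩ := h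
  obtain ⟨φ⟩ := Function.Embedding.nonempty_of_card_le (α := Φ) (β := Fin (2 ^ F)) (by simpa)
  obtain ⟨γ⟩ := Function.Embedding.nonempty_of_card_le (α := Γ)
    (β := Fin ⌊(2 : ℝ) ^ (M * F)⌋₊) (by simpa)
  obtain ⟨β⟩ := Function.Embedding.nonempty_of_card_le (α := B)
    (β := Fin ⌊(2 : ℝ) ^ (R * F)⌋₊) (by simpa)
  let r : P.Ω := Classical.arbitrary _
  have : Nonempty Φ := Fintype.card_pos_iff.1 hp₀
  let x : Φ := Classical.arbitrary _
  have : Nonempty Γ := ⟨P.cache (fun _ => x) r ⟨0, hK⟩⟩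
  have : Nonempty B := ⟨P.message (fun _ => ⟨0, hN⟩) (fun _ => x) r⟩
  have hγ := Function.leftInverse_invFun γ.injective
  refine ⟨P.toScheme φ (Function.invFun φ) γ (Function.invFun γ) β (Function.invFun β),
    (P.toScheme_errorProb φ _ (Function.leftInverse_invFun φ.injective) hγ
      (Function.leftInverse_invFun β.injective)).trans hε, P.toScheme_leakage φ _ hγ⟩

/-! ### Arbitrary file sizes and memory sharing -/

open Filter Topology

/-- For every file size `s` (a real number of bits), there are perfect schemes with memory `M` and
rate `R` whose number of file values is asymptotically `2 ^ s`. -/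
def AsymptoticallyFeasible (N K : ℕ) (x : ℝ × ℝ) : Prop :=
  ∀ η : ℝ, 0 < η → ∀ᶠ s : ℝ in atTop, ∃ p a b : ℕ, PerfectlyFeasible N K p a b ∧
    (1 - η) * (2 : ℝ) ^ s ≤ p ∧ (p : ℝ) ≤ 2 ^ s ∧ (a : ℝ) ≤ 2 ^ (x.1 * s) ∧ (b : ℝ) ≤ 2 ^ (x.2 * s)

theorem AsymptoticallyFeasible.privatelyAchievable {N K : ℕ} (hN : 1 ≤ N) (hK : 1 ≤ K) {M R : ℝ}
    (h : AsymptoticallyFeasible N K (M, R)) : PrivatelyAchievable N K M R := by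
  intro ε hε δ hδ
  have hN' : (0 : ℝ) < N := by exact_mod_cast hN
  -- The bound `1 / 2` keeps `p` positive; `ε / N` bounds the error through Bernoulli's inequality
  -- `(1 - η) ^ N ≥ 1 - N η`.
  have hη : 0 < min (1 / 2) (ε / N) := lt_min (by norm_num) (by positivity)
  have h1 := (tendsto_natCast_atTop_atTop (R := ℝ)).eventually (h _ hη)
  obtain ⟨F₀, hF₀⟩ := eventually_atTop.1 h1
  refine ⟨F₀, fun F hF => ?_⟩
  obtain ⟨p, a, b, hf, hp1, hp2, ha, hb⟩ := hF₀ F hF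
  rw [Real.rpow_natCast] at hp1 hp2
  set η := min (1 / 2 : ℝ) (ε / N) with hη_def
  have hη2 : η ≤ 1 / 2 := min_le_left _ _
  have hpow : (0 : ℝ) < 2 ^ F := by positivity
  have hp0 : 0 < p := by
    have : (0 : ℝ) < p := lt_of_lt_of_le (mul_pos (by linarith) hpow) hp1
    exact_mod_cast this
  obtain ⟨S, hS1, hS2⟩ := PerfectlyFeasible.existsPrivateScheme (ε := ε) hN hK
    (hf.mono (Nat.le_floor ha) (Nat.le_floor hb)) hp0 (by exact_mod_cast hp2) (by
      have hle : 1 - η ≤ (p : ℝ) / 2 ^ F := by rwa [le_div_iff₀ hpow]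
      have h2 := one_add_mul_le_pow (show (-2 : ℝ) ≤ -η by linarith) N
      have h3 : (1 + -η) ^ N ≤ ((p : ℝ) / 2 ^ F) ^ N :=
        pow_le_pow_left₀ (by linarith) (by linarith) N
      have h4 : N * η ≤ ε := by
        have := mul_le_mul_of_nonneg_left (min_le_right (1 / 2 : ℝ) (ε / N)) hN'.le
        rwa [mul_div_cancel₀ _ hN'.ne'] at this
      linarith)
  exact ⟨S, hS1, hS2.trans hδ.le⟩

/-- Memory sharing: of `s` bits, `α s` go to one scheme and `β s` to the other. These are rarely
integers, which is why the file size is a real number. -/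
theorem convex_setOf_asymptoticallyFeasible (N K : ℕ) :
    Convex ℝ {x | AsymptoticallyFeasible N K x} := by
  rw [convex_iff_forall_pos]
  intro x hx y hy α β hα hβ hαβ η hη
  have hη' : 0 < min (1 / 2) (η / 2) := lt_min (by norm_num) (by positivity)
  have h1 := (tendsto_id.const_mul_atTop hα).eventually (hx _ hη')
  have h2 := (tendsto_id.const_mul_atTop hβ).eventually (hy _ hη')
  filter_upwards [h1, h2] with s h1 h2
  obtain ⟨p, a, b, hf, hp1, hp2, ha, hb⟩ := h1
  obtain ⟨p', a', b', hf', hp1', hp2', ha', hb'⟩ := h2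
  simp only [id] at *
  set θ := min (1 / 2) (η / 2)
  have hθ1 : θ ≤ 1 / 2 := min_le_left _ _
  have hθ2 : θ ≤ η / 2 := min_le_right _ _
  have hs : (2 : ℝ) ^ s = 2 ^ (α * s) * 2 ^ (β * s) := by
    rw [← Real.rpow_add two_pos, ← add_mul, hαβ, one_mul]
  refine ⟨p * p', a * a', b * b', hf.mul hf', ?_, ?_, ?_, ?_⟩
  · push_cast
    have h3 := mul_le_mul hp1 hp1' (mul_nonneg (by linarith) (by positivity)) (by positivity)
    have h4 : (1 - η) * (2 : ℝ) ^ s ≤ (1 - θ) ^ 2 * 2 ^ s :=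
      mul_le_mul_of_nonneg_right (by nlinarith) (by positivity)
    rw [hs] at h4 ⊢
    linarith
  · push_cast
    rw [hs]
    exact mul_le_mul hp2 hp2' (by positivity) (by positivity)
  · push_cast
    refine (mul_le_mul ha ha' (by positivity) (by positivity)).trans_eq ?_
    rw [← Real.rpow_add two_pos]
    congr 1
    simp
    ring
  · push_cast
    refine (mul_le_mul hb hb' (by positivity) (by positivity)).trans_eq ?_
    rw [← Real.rpow_add two_pos]
    congr 1
    simp
    ring

theorem asymptoticallyFeasible_of_subpackets (N : ℕ) {K t : ℕ} (hK : 1 ≤ K) (ht : t + 1 ≤ K)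
    {M R : ℝ} (hM : (cacheSubpackets N K t : ℝ) = M * ((K - 1).choose t : ℕ))
    (hR : (K.choose (t + 1) : ℝ) = R * ((K - 1).choose t : ℕ)) :
    AsymptoticallyFeasible N K (M, R) := by
  intro η hη
  set c := (K - 1).choose t with hc_def
  have hc : 0 < (c : ℝ) := by exact_mod_cast Nat.choose_pos (by omega)
  -- With `y = 2 ^ (s / c)` and subpackets in `ZMod ⌊y⌋₊`, rounding costs at most a factor `(1 - 1 /
  -- y) ^ c`, which tends to `1`.
  have hlim : Tendsto (fun s : ℝ => (1 - ((2 : ℝ) ^ (s / c))⁻¹) ^ c) atTop (𝓝 1) := by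
    have h1 : Tendsto (fun s : ℝ => (2 : ℝ) ^ (s / c)) atTop atTop :=
      (tendsto_rpow_atTop_of_base_gt_one 2 one_lt_two).comp (tendsto_id.atTop_div_const hc)
    simpa using (h1.inv_tendsto_atTop.const_sub 1).pow c
  filter_upwards [hlim.eventually (lt_mem_nhds (show 1 - η < 1 by linarith)),
    eventually_ge_atTop 0] with s hs hs0
  set y : ℝ := 2 ^ (s / c) with hy
  have hy1 : 1 ≤ y := Real.one_le_rpow one_le_two (by positivity)
  have hypow : ∀ (x : ℝ) (n : ℕ), (n : ℝ) = x * c → y ^ n = 2 ^ (x * s) := by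
    intro x n hn
    rw [hy, ← Real.rpow_natCast, ← Real.rpow_mul zero_le_two, hn]
    congr 1
    field_simp
  have hfl : (⌊y⌋₊ : ℝ) ≤ y := Nat.floor_le (by linarith)
  refine ⟨_, _, _, perfectlyFeasible_pow N hK t ⌊y⌋₊ (Nat.floor_pos.2 hy1).ne', ?_, ?_, ?_, ?_⟩
  · have h1 : y - 1 ≤ ⌊y⌋₊ := by linarith [Nat.lt_floor_add_one y]
    have hy2 := hypow 1 c (one_mul _).symm
    rw [one_mul] at hy2
    rw [← hy2]
    calc (1 - η) * y ^ c ≤ (1 - y⁻¹) ^ c * y ^ c := by gcongr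
      _ = (y - 1) ^ c := by rw [← mul_pow]; congr 1; field_simp
      _ ≤ (⌊y⌋₊ : ℝ) ^ c := pow_le_pow_left₀ (by linarith) h1 c
      _ = _ := by push_cast; rfl
  · push_cast
    refine (pow_le_pow_left₀ (by positivity) hfl _).trans_eq ?_
    rw [hypow 1 _ (by rw [one_mul]), one_mul]
  · push_cast
    exact (pow_le_pow_left₀ (by positivity) hfl _).trans_eq (hypow _ _ hM)
  · push_cast
    exact (pow_le_pow_left₀ (by positivity) hfl _).trans_eq (hypow _ _ hR)

theorem perfectlyAchievable_of_subpackets {N K t : ℕ} (hN : 1 ≤ N) (hK : 1 ≤ K) (ht : t + 1 ≤ K)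
    {M R : ℝ} (hM : (cacheSubpackets N K t : ℝ) = M * ((K - 1).choose t : ℕ))
    (hR : (K.choose (t + 1) : ℝ) = R * ((K - 1).choose t : ℕ)) :
    PerfectlyAchievable N K M R := by
  refine ⟨(K - 1).choose t, Nat.choose_pos (by omega), ?_⟩
  rintro F ⟨m, rfl⟩
  set c := (K - 1).choose t
  have hpow : ∀ (x : ℝ) (n : ℕ), (n : ℝ) = x * c →
      ⌊(2 : ℝ) ^ (x * ((c * m : ℕ) : ℝ))⌋₊ = (2 ^ m) ^ n := by
    intro x n hn
    have : (2 : ℝ) ^ (x * ((c * m : ℕ) : ℝ)) = (((2 ^ m) ^ n : ℕ) : ℝ) := by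
      push_cast
      rw [← mul_assoc, ← hn, ← pow_mul, ← Real.rpow_natCast]
      congr 1
      push_cast
      ring
    rw [this, Nat.floor_natCast]
  have hp : (2 ^ m) ^ c = 2 ^ (c * m) := by rw [← pow_mul, mul_comm]
  refine PerfectlyFeasible.existsPrivateScheme hN hK (p := (2 ^ m) ^ c) ?_ (by positivity) hp.le ?_
  · rw [hpow _ _ hM, hpow _ _ hR]
    exact perfectlyFeasible_pow N hK t (2 ^ m) (by positivity)
  · rw [hp]
    push_cast
    rw [div_self (by positivity), one_pow, sub_self]

theorem choose_pred_eq {K : ℕ} (hK : 1 ≤ K) :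
    (K.choose (K - 1 + 1) : ℝ) = 1 * ((K - 1).choose (K - 1) : ℕ) := by
  rw [Nat.sub_add_cancel hK, Nat.choose_self, Nat.choose_self, one_mul]

/-! ### The lower convex envelope -/

theorem finite_cornerPoints (N K : ℕ) : (cornerPoints N K).Finite := by
  refine Set.Finite.union (Set.Finite.subset ((Set.finite_lt_nat K).image fun t =>
    (cornerMemory N K t, rateC N K (cornerMemory N K t))) ?_) (Set.finite_singleton _)
  rintro p ⟨t, ht, rfl⟩
  exact ⟨t, Set.mem_ofPred.2 (by omega), rfl⟩

theorem convexHull_cornerPoints_subset {N K : ℕ} (hN : 1 ≤ N) (hK : 1 ≤ K) :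
    convexHull ℝ (cornerPoints N K) ⊆ {x | AsymptoticallyFeasible N K x} := by
  refine convexHull_min ?_ (convex_setOf_asymptoticallyFeasible N K)
  rintro p (⟨t, ht, rfl⟩ | rfl)
  · exact asymptoticallyFeasible_of_subpackets N hK (by omega)
      (cacheSubpackets_eq_cornerMemory N ht) (choose_succ_eq_rateC hN ht)
  · exact asymptoticallyFeasible_of_subpackets N hK (by omega)
      (cacheSubpackets_pred N hK) (choose_pred_eq hK)

theorem exists_isLeast_convexHull_cornerPoints {N K : ℕ} {M : ℝ} (h1 : 1 ≤ M)
    (h2 : M ≤ N * ((K : ℝ) - 1)) :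
    ∃ R, IsLeast {r : ℝ | (M, r) ∈ convexHull ℝ (cornerPoints N K)} R := by
  have hcpt : IsCompact (convexHull ℝ (cornerPoints N K)) :=
    (finite_cornerPoints N K).isCompact_convexHull (𝕜 := ℝ)
  have hK : 2 ≤ K := by
    by_contra hK
    have h3 : (K : ℝ) ≤ 1 := by exact_mod_cast (by omega : K ≤ 1)
    have : (N : ℝ) * ((K : ℝ) - 1) ≤ 0 :=
      mul_nonpos_of_nonneg_of_nonpos N.cast_nonneg (by linarith)
    linarith
  have hset : {r : ℝ | (M, r) ∈ convexHull ℝ (cornerPoints N K)} =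
      Prod.snd '' (convexHull ℝ (cornerPoints N K) ∩ Prod.fst ⁻¹' {M}) := by
    ext r
    constructor
    · intro hr
      exact ⟨(M, r), ⟨hr, rfl⟩, rfl⟩
    · rintro ⟨⟨_, _⟩, ⟨hx, rfl⟩, rfl⟩
      exact hx
  rw [hset]
  refine IsCompact.exists_isLeast ((hcpt.inter_right
    (isClosed_singleton.preimage continuous_fst)).image continuous_snd) ?_
  -- The hull projects onto an interval containing the abscissas `1`, from `t = 0`, and `N(K-1)`.
  have hfst : M ∈ Prod.fst '' convexHull ℝ (cornerPoints N K) := by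
    have hconv : Convex ℝ (Prod.fst '' convexHull ℝ (cornerPoints N K)) :=
      (convex_convexHull ℝ _).linear_image (LinearMap.fst ℝ ℝ ℝ)
    have hord : (Prod.fst '' convexHull ℝ (cornerPoints N K)).OrdConnected :=
      convex_iff_ordConnected.1 hconv
    exact hord.out
      (x := 1) ⟨(cornerMemory N K 0, rateC N K (cornerMemory N K 0)),
        subset_convexHull ℝ _ (Or.inl ⟨0, by omega, rfl⟩), by simp [cornerMemory]⟩
      (y := N * ((K : ℝ) - 1)) ⟨(_, 1), subset_convexHull ℝ _ (Or.inr rfl), rfl⟩ ⟨h1, h2⟩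
  obtain ⟨x, hx, hxM⟩ := hfst
  exact ⟨x.2, x, ⟨hx, hxM⟩, rfl⟩

end PrivateCaching

theorem theorem1 (N K : ℕ) (hN : 1 ≤ N) (hK : 1 ≤ K) :
    (∀ t : ℕ, t + 2 ≤ K → ∀ M : ℝ, M = (N : ℝ) * t / ((K : ℝ) - t) + 1 →
      PrivateCaching.PrivatelyAchievable N K M (PrivateCaching.rateC N K M) ∧
      PrivateCaching.PerfectlyAchievable N K M (PrivateCaching.rateC N K M)) ∧
    (PrivateCaching.PrivatelyAchievable N K ((N : ℝ) * ((K : ℝ) - 1)) 1 ∧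
      PrivateCaching.PerfectlyAchievable N K ((N : ℝ) * ((K : ℝ) - 1)) 1) ∧
    (∀ M : ℝ, 1 ≤ M → M ≤ (N : ℝ) * ((K : ℝ) - 1) →
      ∃ R : ℝ,
        IsLeast {r : ℝ | (M, r) ∈ convexHull ℝ (PrivateCaching.cornerPoints N K)} R ∧
        PrivateCaching.PrivatelyAchievable N K M R) := by
  refine ⟨?_, ⟨?_, ?_⟩, ?_⟩
  · rintro t ht M rfl
    exact ⟨(PrivateCaching.convexHull_cornerPoints_subset hN hK
        (subset_convexHull ℝ _ (Or.inl ⟨t, ht, rfl⟩))).privatelyAchievable hN hK,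
      PrivateCaching.perfectlyAchievable_of_subpackets hN hK (by omega)
        (PrivateCaching.cacheSubpackets_eq_cornerMemory N ht)
        (PrivateCaching.choose_succ_eq_rateC hN ht)⟩
  · exact (PrivateCaching.convexHull_cornerPoints_subset hN hK
      (subset_convexHull ℝ _ (Or.inr rfl))).privatelyAchievable hN hK
  · exact PrivateCaching.perfectlyAchievable_of_subpackets hN hK (by omega)
      (PrivateCaching.cacheSubpackets_pred N hK) (PrivateCaching.choose_pred_eq hK)
  · intro M h1 h2
    obtain ⟨R, hR⟩ := PrivateCaching.exists_isLeast_convexHull_cornerPoints h1 h2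
    exact ⟨R, hR, (PrivateCaching.convexHull_cornerPoints_subset hN hK
      hR.1).privatelyAchievable hN hK⟩
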